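/- Let $\alpha\in[0,1)$. For a finite simple graph $G$ with adjacency matrix $A(G)$ and diagonal matrix of vertex degrees $D(G)$, put $A_\alpha(G)=\alpha D(G)+(1-\alpha)A(G)$ and let $\rho_\alpha(G)$ be the spectral radius of $A_\alpha(G)$. For integers $p\ge 2$ and $q,r\ge 1$, let $B_{p,q,r}$ be the graph of order $p+q+r-2$ obtained from the complete graph $K_p$ by deleting an edge $uv$ and attaching a path $P_q$ at $u$ and a path $P_r$ at $v$; here $P_q$ has $q$ vertices and one of its ends is identified with $u$, and likewise for $P_r$ and $v$. Let $G$ be a connected simple graph of order $n$ with $\mathrm{diam}(G)\ge k$. If $k=1$, then $\rho_\alpha(G)\le\rho_\alpha(K_n)$, with equality if and only if $G$ is isomorphic to $K_n$; in particular, $\rho_\alpha(G)=\rho_\alpha(K_n)$ if $\mathrm{diam}(G)=1$. If $k\ge 2$, then $$\rho_\alpha(G)\le\rho_\alpha\bigl(B_{n-k+2,\lfloor k/2\rfloor,\lceil k/2\rceil}\bigr),$$ with equality if and only if $G$ is isomorphic to $B_{n-k+2,\lfloor k/2\rfloor,\lceil k/2\rceil}$. -/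

import Mathlib

open scoped ENNReal

/-- The matrix `A_α(G) = α D(G) + (1 - α) A(G)`, where `D(G)` is the diagonal matrix of the vertex
degrees of `G` and `A(G)` is its adjacency matrix. -/
noncomputable def alphaMatrix {V : Type*} [Fintype V] [DecidableEq V] (α : ℝ)
    (G : SimpleGraph V) [DecidableRel G.Adj] : Matrix V V ℝ :=
  α • G.degMatrix ℝ + (1 - α) • G.adjMatrix ℝ

open Classical in
/-- The `α`-index `ρ_α(G)`: the spectral radius of the real symmetric matrix `A_α(G)`, i.e. the
largest absolute value of an eigenvalue. -/
noncomputable def alphaIndex {V : Type*} [Fintype V] (α : ℝ) (G : SimpleGraph V) : ℝ≥0∞ :=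
  spectralRadius ℝ (alphaMatrix α G)

/-- The graph obtained by attaching a path `P_q` (`q ≥ 1` vertices) to the vertex `u` of `G`:
an end of `P_q` is identified with `u`, so that the path is
`u, inr 0, inr 1, …, inr (q - 2)` and `q - 1` new vertices are added. -/
def attachPath {V : Type*} (G : SimpleGraph V) (u : V) (q : ℕ) :
    SimpleGraph (V ⊕ Fin (q - 1)) where
  Adj
    | .inl a, .inl b => G.Adj a b
    | .inl a, .inr j => a = u ∧ j.val = 0
    | .inr i, .inl b => b = u ∧ i.val = 0
    | .inr i, .inr j => i.val + 1 = j.val ∨ j.val + 1 = i.val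
  symm := ⟨by
    rintro (a | i) (b | j) h
    · exact h.symm
    · exact h
    · exact h
    · exact Or.symm h⟩
  loopless := ⟨by
    rintro (a | i) h
    · exact h.ne rfl
    · rcases h with h | h <;> omega⟩

/-- The graph `B_{p,q,r}` (`p ≥ 2`, `q, r ≥ 1`), of order `p + q + r - 2`: the edge joining the
vertices `0` and `1` of the complete graph `K_p` is deleted, a path `P_q` is attached to `0` and a
path `P_r` is attached to `1`. -/
def bugGraph (p q r : ℕ) (hp : 2 ≤ p) : SimpleGraph ((Fin p ⊕ Fin (q - 1)) ⊕ Fin (r - 1)) :=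
  attachPath
    (attachPath
      ((⊤ : SimpleGraph (Fin p)).deleteEdges {s(⟨0, by omega⟩, ⟨1, by omega⟩)})
      ⟨0, by omega⟩ q)
    (Sum.inl ⟨1, by omega⟩) r

/-!
# The largest `α`-index of a connected graph of given order and diameter

The case `k = 1` is the strict monotonicity of the `α`-index under adding edges to a connected graph
(`alphaIndex_lt_of_lt`).

For `k ≥ 2`, let `f v` be the distance of `v` from an end of a diametral path, cut off at `k`. All
layers `0, …, k` of `f` are nonempty and adjacent vertices lie in equal or consecutive layers, so
`G` is contained in `layerGraph f`, the graph with all edges of that kind. It remains to maximise the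
`α`-index over the finitely many layerings `f` of the vertex set. The graph `B_{p,q,r}` is the layer
graph with one layer of size `p - 2` and all others singletons (`bugGraph_eq_layerGraph`).

Let `f` be optimal, with index `lam` and Perron vector `x`. If the quadratic form of another layer
graph is at `x` at least that of `layerGraph f`, then its index is at least `lam`, and it is larger
unless `x` is an eigenvector of both (`IsPerron.index_lt`). Optimality therefore excludes two moves:
shifting part of a layer to the next one (`IsPerron.index_lt_shift`), and reversing a window of
layers with singletons at both boundaries (`IsPerron.index_lt_reverse`), provided that the entries
of `x` at the boundaries compare in the right way. This determines `f`:

* `lam > |V| - k`, as some layer graph properly contains a clique with `|V| - k + 1` vertices. By the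
  maximum principle (`IsPerron.le_degree`) some vertex then has degree greater than `|V| - k`, which
  puts all large layers among three consecutive ones.
* Of these, the outer two are not both large (`IsOptimal.not_two_large`), nor are two consecutive
  ones (`IsOptimal.not_consecutive_large`), so there is a single large layer.
* The large layer is central (`IsOptimal.large_layer_central`): otherwise an induction compares the
  entries of `x` on both sides of it until the shorter side runs out.
-/

/-! ### The operator and the quadratic form of `A_α(G)` -/

open Classical in
/-- The value at `u` of `A_α(G) x`, written as a sum over the neighbours of `u`. -/
noncomputable def alphaAct {V : Type*} [Fintype V] (α : ℝ) (G : SimpleGraph V) (x : V → ℝ)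
    (u : V) : ℝ :=
  ∑ v, if G.Adj u v then α * x u + (1 - α) * x v else 0

/-- The quadratic form `xᵀ A_α(G) x`. -/
noncomputable def alphaForm {V : Type*} [Fintype V] (α : ℝ) (G : SimpleGraph V) (x : V → ℝ) : ℝ :=
  ∑ u, x u * alphaAct α G x u

/-! ### The Rayleigh quotient and the Perron vector of `A_α(G)` -/

section Matrix

open Matrix

variable {V : Type*} [Fintype V]

theorem mulVec_eq_smul_of_form_eq {M : Matrix V V ℝ} (hM : M.IsSymm) {lam : ℝ}
    (hmax : ∀ y, y ⬝ᵥ M *ᵥ y ≤ lam * (y ⬝ᵥ y)) {x : V → ℝ}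
    (hx : x ⬝ᵥ M *ᵥ x = lam * (x ⬝ᵥ x)) : M *ᵥ x = lam • x := by
  classical
  have hform : ∀ y, y ⬝ᵥ (lam • (1 : Matrix V V ℝ) - M) *ᵥ y = lam * (y ⬝ᵥ y) - y ⬝ᵥ M *ᵥ y := by
    intro y
    rw [sub_mulVec, dotProduct_sub, smul_mulVec, one_mulVec, dotProduct_smul, smul_eq_mul]
  have hpsd : (lam • (1 : Matrix V V ℝ) - M).PosSemidef := by
    refine Matrix.PosSemidef.of_dotProduct_mulVec_nonneg ?_ ?_
    · have : (lam • (1 : Matrix V V ℝ) - M).IsSymm := by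
        simp [Matrix.IsSymm, hM.eq]
      rwa [Matrix.IsHermitian, Matrix.conjTranspose_eq_transpose_of_trivial]
    · intro y
      rw [star_trivial, hform]
      linarith [hmax y]
  have h0 := (hpsd.dotProduct_mulVec_zero_iff x).1 (by rw [star_trivial, hform]; linarith)
  rw [sub_mulVec, smul_mulVec, one_mulVec] at h0
  exact (sub_eq_zero.1 h0).symm

/-- The elementary half of the Perron–Frobenius theorem for a symmetric nonnegative matrix: its
spectral radius is the maximum of the Rayleigh quotient and has a nonnegative eigenvector. -/
theorem exists_nonneg_eigenvector [Nonempty V] [DecidableEq V] {M : Matrix V V ℝ} (hM : M.IsSymm)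
    (hpos : ∀ i j, 0 ≤ M i j) :
    ∃ (lam : ℝ) (x : V → ℝ), 0 ≤ lam ∧ (∀ v, 0 ≤ x v) ∧ x ≠ 0 ∧ M *ᵥ x = lam • x ∧
      (∀ y, y ⬝ᵥ M *ᵥ y ≤ lam * (y ⬝ᵥ y)) ∧ spectralRadius ℝ M = ENNReal.ofReal lam := by
  let Q : (V → ℝ) → ℝ := fun y => y ⬝ᵥ M *ᵥ y
  have hQabs : ∀ y : V → ℝ, |Q y| ≤ Q (fun v => |y v|) := by
    intro y
    simp only [Q, dotProduct, mulVec]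
    refine (Finset.abs_sum_le_sum_abs _ _).trans (Finset.sum_le_sum fun i _ => ?_)
    rw [abs_mul]
    refine mul_le_mul_of_nonneg_left ?_ (abs_nonneg _)
    refine (Finset.abs_sum_le_sum_abs _ _).trans (Finset.sum_le_sum fun j _ => ?_)
    rw [abs_mul, abs_of_nonneg (hpos i j)]
  have habs : ∀ y : V → ℝ, (fun v => |y v|) ⬝ᵥ (fun v => |y v|) = y ⬝ᵥ y := by
    intro y
    simp [dotProduct, abs_mul_abs_self]
  have hcomp : IsCompact {y : V → ℝ | y ⬝ᵥ y = 1} := by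
    refine Metric.isCompact_of_isClosed_isBounded ?_ ?_
    · exact isClosed_eq (by unfold dotProduct; fun_prop) continuous_const
    · refine (Metric.isBounded_closedBall (x := (0 : V → ℝ)) (r := 1)).subset fun y hy => ?_
      rw [mem_closedBall_zero_iff, pi_norm_le_iff_of_nonneg zero_le_one]
      intro i
      have h1 : y i * y i ≤ y ⬝ᵥ y :=
        Finset.single_le_sum (f := fun i => y i * y i) (fun j _ => mul_self_nonneg _)
          (Finset.mem_univ i)
      rw [Set.mem_ofPred_eq] at hy
      rw [Real.norm_eq_abs, abs_le_one_iff_mul_self_le_one]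
      linarith
  have hne : {y : V → ℝ | y ⬝ᵥ y = 1}.Nonempty :=
    ⟨Pi.single (Classical.arbitrary V) 1, by simp⟩
  obtain ⟨z, hz, hzmax⟩ := hcomp.exists_isMaxOn hne
    (show ContinuousOn Q _ by
      refine Continuous.continuousOn ?_
      simp only [Q, dotProduct, mulVec]
      fun_prop)
  rw [Set.mem_ofPred_eq] at hz
  have hmax : ∀ y, Q y ≤ Q z * (y ⬝ᵥ y) := by
    intro y
    by_cases hy : y = 0
    · simp [hy, Q]
    · have hyp : 0 < y ⬝ᵥ y := by
        refine lt_of_le_of_ne (Finset.sum_nonneg fun j _ => mul_self_nonneg _) ?_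
        intro h
        exact hy (dotProduct_self_eq_zero.1 h.symm)
      set c := Real.sqrt (y ⬝ᵥ y) with hc
      have hcc : c * c = y ⬝ᵥ y := Real.mul_self_sqrt hyp.le
      have hc0 : c ≠ 0 := (Real.sqrt_pos.2 hyp).ne'
      have hmem : (c⁻¹ • y) ⬝ᵥ (c⁻¹ • y) = 1 := by
        rw [smul_dotProduct, dotProduct_smul, ← hcc, smul_eq_mul, smul_eq_mul]
        field_simp
      have h1 : Q (c⁻¹ • y) ≤ Q z := hzmax hmem
      have h2 : Q (c⁻¹ • y) = (c * c)⁻¹ * Q y := by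
        simp only [Q, mulVec_smul, smul_dotProduct, dotProduct_smul, smul_eq_mul]
        rw [mul_inv, mul_assoc]
      rw [h2, hcc, inv_mul_le_iff₀ hyp] at h1
      linarith
  let x : V → ℝ := fun v => |z v|
  have hxx : x ⬝ᵥ x = 1 := (habs z).trans hz
  have hQx : Q x = Q z * (x ⬝ᵥ x) :=
    le_antisymm (hmax x) (by rw [hxx, mul_one]; exact (le_abs_self _).trans (hQabs z))
  have hlam : 0 ≤ Q z := by
    have := (abs_nonneg _).trans (hQabs z)
    change 0 ≤ Q x at this
    rwa [hQx, hxx, mul_one] at this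
  have hx0 : x ≠ 0 := by
    intro h
    rw [h, zero_dotProduct] at hxx
    exact zero_ne_one hxx
  have heig : M *ᵥ x = Q z • x := mulVec_eq_smul_of_form_eq hM hmax hQx
  refine ⟨Q z, x, hlam, fun v => abs_nonneg _, hx0, heig, hmax, ?_⟩
  have hspec : ∀ μ : ℝ, μ ∈ spectrum ℝ M ↔ ∃ y : V → ℝ, M *ᵥ y = μ • y ∧ y ≠ 0 := by
    intro μ
    rw [← Matrix.spectrum_toLin', ← Module.End.hasEigenvalue_iff_mem_spectrum]
    constructor
    · intro h
      obtain ⟨y, hy⟩ := h.exists_hasEigenvector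
      exact ⟨y, by simpa using hy.apply_eq_smul, hy.2⟩
    · rintro ⟨y, hy, hy0⟩
      exact Module.End.hasEigenvalue_of_hasEigenvector
        ⟨Module.End.mem_eigenspace_iff.2 (by simpa using hy), hy0⟩
  refine le_antisymm (iSup₂_le fun μ hμ => ?_) ?_
  · obtain ⟨y, hy, hy0⟩ := (hspec μ).1 hμ
    have hyp : 0 < y ⬝ᵥ y := by
      refine lt_of_le_of_ne (Finset.sum_nonneg fun j _ => mul_self_nonneg _) ?_
      intro h
      exact hy0 (dotProduct_self_eq_zero.1 h.symm)
    have h1 : |μ| * (y ⬝ᵥ y) ≤ Q z * (y ⬝ᵥ y) := by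
      calc |μ| * (y ⬝ᵥ y) = |Q y| := by
            simp only [Q, hy, dotProduct_smul, smul_eq_mul, abs_mul, abs_of_pos hyp]
        _ ≤ Q (fun v => |y v|) := hQabs y
        _ ≤ Q z * (y ⬝ᵥ y) := by rw [← habs y]; exact hmax _
    have h2 : |μ| ≤ Q z := le_of_mul_le_mul_right h1 hyp
    rw [← enorm_eq_nnnorm, ← ofReal_norm, Real.norm_eq_abs]
    exact ENNReal.ofReal_le_ofReal h2
  · have hmem : Q z ∈ spectrum ℝ M := (hspec _).2 ⟨x, heig, hx0⟩
    refine le_trans (le_of_eq ?_) (le_iSup₂ (f := fun (μ : ℝ) (_ : μ ∈ spectrum ℝ M) =>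
      (‖μ‖₊ : ℝ≥0∞)) (Q z) hmem)
    rw [← enorm_eq_nnnorm, Real.enorm_of_nonneg hlam]

end Matrix

section Perron

variable {V : Type*} [Fintype V] {α : ℝ} {G H : SimpleGraph V} {lam : ℝ} {x : V → ℝ}

open Classical in
theorem alphaMatrix_mulVec (α : ℝ) (G : SimpleGraph V) (x : V → ℝ) :
    (alphaMatrix α G).mulVec x = alphaAct α G x := by
  ext u
  have h1 : (∑ v, if G.Adj u v then α * x u + (1 - α) * x v else 0)
      = α * ((G.degree u : ℝ) * x u) + (1 - α) * ∑ v ∈ G.neighborFinset u, x v := by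
    rw [← Finset.sum_filter, Finset.sum_add_distrib, Finset.sum_const, ← Finset.mul_sum,
      nsmul_eq_mul, ← G.neighborFinset_eq_filter, G.card_neighborFinset_eq_degree]
    ring
  rw [alphaAct, h1, alphaMatrix, Matrix.add_mulVec, Matrix.smul_mulVec, Matrix.smul_mulVec,
    SimpleGraph.degMatrix, Pi.add_apply, Pi.smul_apply, Pi.smul_apply, Matrix.mulVec_diagonal,
    SimpleGraph.adjMatrix_mulVec_apply, smul_eq_mul, smul_eq_mul]

open Classical in
theorem alphaForm_eq (α : ℝ) (G : SimpleGraph V) (x : V → ℝ) :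
    alphaForm α G x =
      ∑ u, ∑ v, (if G.Adj u v then α * x u ^ 2 + (1 - α) * (x u * x v) else 0) := by
  simp only [alphaForm, alphaAct, Finset.mul_sum, mul_ite, mul_zero]
  refine Finset.sum_congr rfl fun u _ => Finset.sum_congr rfl fun v _ => ?_
  congr 1
  ring

/-- `lam` is the `α`-index of `G` and `x` a positive eigenvector for it; `form_le` says that `lam`
is the maximum of the Rayleigh quotient of `A_α(G)`. -/
structure IsPerron (α : ℝ) (G : SimpleGraph V) (lam : ℝ) (x : V → ℝ) : Prop where
  pos : ∀ v, 0 < x v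
  act_eq : ∀ v, alphaAct α G x v = lam * x v
  form_le : ∀ y, alphaForm α G y ≤ lam * ∑ v, y v * y v
  index_eq : alphaIndex α G = ENNReal.ofReal lam

open Classical in
theorem alphaMatrix_isSymm (α : ℝ) (G : SimpleGraph V) : (alphaMatrix α G).IsSymm := by
  simp [alphaMatrix, SimpleGraph.degMatrix, Matrix.IsSymm]

theorem act_eq_of_form_eq (hmax : ∀ y, alphaForm α G y ≤ lam * ∑ v, y v * y v)
    (hx : alphaForm α G x = lam * ∑ v, x v * x v) (v : V) : alphaAct α G x v = lam * x v := by
  classical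
  have h := mulVec_eq_smul_of_form_eq (alphaMatrix_isSymm α G) (lam := lam) (x := x)
    (fun y => by rw [alphaMatrix_mulVec]; exact hmax y) (by rw [alphaMatrix_mulVec]; exact hx)
  rw [alphaMatrix_mulVec] at h
  exact congrFun h v

/-- A nonnegative eigenvector of a connected graph has no zero entry: a zero entry spreads to all
neighbours. -/
theorem pos_of_act_eq (hG : G.Connected) (hα : α ∈ Set.Ico (0 : ℝ) 1) (hx : ∀ v, 0 ≤ x v)
    (hx0 : x ≠ 0) (h : ∀ v, alphaAct α G x v = lam * x v) (v : V) : 0 < x v := by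
  classical
  have hspread : ∀ u w, G.Adj u w → x u = 0 → x w = 0 := by
    intro u w huw hu
    have h1 := h u
    rw [hu, mul_zero, alphaAct, Finset.sum_eq_zero_iff_of_nonneg] at h1
    · have h2 := h1 w (Finset.mem_univ w)
      rw [if_pos huw, hu, mul_zero, zero_add] at h2
      exact (mul_eq_zero.1 h2).resolve_left (by linarith [hα.2])
    · intro w _
      split_ifs
      · exact add_nonneg (mul_nonneg hα.1 (hx u)) (mul_nonneg (by linarith [hα.2]) (hx w))
      · exact le_rfl
  refine lt_of_le_of_ne (hx v) fun h0 => hx0 ?_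
  ext w
  obtain ⟨p⟩ := hG.preconnected v w
  clear hx0
  induction p with
  | nil => exact h0.symm
  | cons hadj _ ih => exact ih (hspread _ _ hadj h0.symm).symm

theorem exists_isPerron (hG : G.Connected) (hα : α ∈ Set.Ico (0 : ℝ) 1) :
    ∃ lam x, IsPerron α G lam x := by
  classical
  have := hG.nonempty
  have hnn : ∀ i j, 0 ≤ alphaMatrix α G i j := by
    intro i j
    simp only [alphaMatrix, SimpleGraph.degMatrix, Matrix.add_apply, Matrix.smul_apply,
      smul_eq_mul, SimpleGraph.adjMatrix_apply, Matrix.diagonal_apply]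
    have h1 : 0 ≤ 1 - α := by linarith [hα.2]
    have h2 := hα.1
    split_ifs <;> positivity
  obtain ⟨lam, x, -, hx, hx0, heig, hmax, hrad⟩ :=
    exists_nonneg_eigenvector (alphaMatrix_isSymm α G) hnn
  have hact : ∀ v, alphaAct α G x v = lam * x v := by
    intro v
    rw [alphaMatrix_mulVec] at heig
    exact congrFun heig v
  exact ⟨lam, x, pos_of_act_eq hG hα hx hx0 hact, hact,
    fun y => by have := hmax y; rwa [alphaMatrix_mulVec] at this, hrad⟩

theorem IsPerron.form_eq (h : IsPerron α G lam x) : alphaForm α G x = lam * ∑ v, x v * x v := by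
  rw [alphaForm, Finset.mul_sum]
  exact Finset.sum_congr rfl fun v _ => by rw [h.act_eq]; ring

theorem IsPerron.lam_nonneg [Nonempty V] (hα : α ∈ Set.Ico (0 : ℝ) 1) (h : IsPerron α G lam x) :
    0 ≤ lam := by
  have v := Classical.arbitrary V
  have h1 : 0 ≤ lam * x v := by
    rw [← h.act_eq, alphaAct]
    refine Finset.sum_nonneg fun w _ => ?_
    split_ifs
    · exact add_nonneg (mul_nonneg hα.1 (h.pos v).le)
        (mul_nonneg (by linarith [hα.2]) (h.pos w).le)
    · exact le_rfl
  exact nonneg_of_mul_nonneg_left h1 (h.pos v)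

/-- The comparison principle behind every strict inequality of `α`-indices: if `G` and `H` had the
same index, then `x` would be an eigenvector of both. -/
theorem IsPerron.index_lt (hα : α ∈ Set.Ico (0 : ℝ) 1) (h : IsPerron α G lam x)
    (hH : H.Connected) (hform : alphaForm α G x ≤ alphaForm α H x) {w : V}
    (hw : alphaAct α G x w ≠ alphaAct α H x w) : alphaIndex α G < alphaIndex α H := by
  obtain ⟨mu, y, hy⟩ := exists_isPerron hH hα
  have := hH.nonempty
  have hxx : 0 < ∑ v, x v * x v :=
    Finset.sum_pos (fun v _ => mul_pos (h.pos v) (h.pos v)) Finset.univ_nonempty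
  have h1 : lam * ∑ v, x v * x v ≤ mu * ∑ v, x v * x v := by
    rw [← h.form_eq]
    exact hform.trans (hy.form_le x)
  have hle : lam ≤ mu := le_of_mul_le_mul_right h1 hxx
  have hne : lam ≠ mu := by
    rintro rfl
    refine hw ?_
    rw [h.act_eq, act_eq_of_form_eq hy.form_le
      (le_antisymm (hy.form_le x) (by rw [← h.form_eq]; exact hform))]
  rw [h.index_eq, hy.index_eq]
  exact (ENNReal.ofReal_lt_ofReal_iff_of_nonneg (h.lam_nonneg hα)).2 (lt_of_le_of_ne hle hne)

theorem alphaIndex_lt_of_lt (hα : α ∈ Set.Ico (0 : ℝ) 1) (hG : G.Connected) (hGH : G < H) :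
    alphaIndex α G < alphaIndex α H := by
  classical
  obtain ⟨lam, x, h⟩ := exists_isPerron hG hα
  have hterm : ∀ u v, 0 < α * x u + (1 - α) * x v := fun u v =>
    add_pos_of_nonneg_of_pos (mul_nonneg hα.1 (h.pos u).le)
      (mul_pos (by linarith [hα.2]) (h.pos v))
  have hentry : ∀ u v, (if G.Adj u v then α * x u + (1 - α) * x v else 0)
      ≤ (if H.Adj u v then α * x u + (1 - α) * x v else 0) := by
    intro u v
    by_cases huv : G.Adj u v
    · rw [if_pos huv, if_pos (hGH.le huv)]
    · rw [if_neg huv]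
      split_ifs
      · exact (hterm u v).le
      · exact le_rfl
  obtain ⟨a, b, hab, hab'⟩ : ∃ a b, H.Adj a b ∧ ¬ G.Adj a b := by
    by_contra! hcon
    exact hGH.not_ge fun a b hab => hcon a b hab
  refine h.index_lt hα (hG.mono hGH.le) (w := a) ?_ (ne_of_lt ?_)
  · exact Finset.sum_le_sum fun u _ => mul_le_mul_of_nonneg_left
      (Finset.sum_le_sum fun v _ => hentry u v) (h.pos u).le
  · refine Finset.sum_lt_sum (fun v _ => hentry a v) ⟨b, Finset.mem_univ b, ?_⟩
    rw [if_neg hab', if_pos hab]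
    exact hterm a b

theorem alphaIndex_le_of_le (hα : α ∈ Set.Ico (0 : ℝ) 1) (hG : G.Connected) (hGH : G ≤ H) :
    alphaIndex α G ≤ alphaIndex α H := by
  rcases hGH.eq_or_lt with rfl | hlt
  · exact le_rfl
  · exact (alphaIndex_lt_of_lt hα hG hlt).le

theorem alphaIndex_congr {W : Type*} [Fintype W] {H : SimpleGraph W} (α : ℝ) (e : G ≃g H) :
    alphaIndex α G = alphaIndex α H := by
  classical
  have hM : Matrix.reindexAlgEquiv ℝ ℝ e.toEquiv (alphaMatrix α G) = alphaMatrix α H := by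
    ext i j
    have hdeg : G.degree (e.symm i) = H.degree i := by
      have := e.degree_eq (e.symm i)
      rw [RelIso.apply_symm_apply] at this
      exact this.symm
    have hadj : G.Adj (e.symm i) (e.symm j) ↔ H.Adj i j := e.symm.map_adj_iff
    have heq : e.symm i = e.symm j ↔ i = j := e.symm.injective.eq_iff
    have hi : ∀ i, e.toEquiv.symm i = e.symm i := fun _ => rfl
    simp only [Matrix.coe_reindexAlgEquiv, Matrix.reindex_apply, Matrix.submatrix_apply,
      alphaMatrix, SimpleGraph.degMatrix, Matrix.add_apply, Matrix.smul_apply, smul_eq_mul,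
      SimpleGraph.adjMatrix_apply, Matrix.diagonal_apply, hi, hdeg, hadj, heq]
  rw [alphaIndex, alphaIndex, spectralRadius, spectralRadius, ← hM, AlgEquiv.spectrum_eq]

open Classical in
/-- The maximum principle: where the Perron vector has a local maximum, the degree is at least the
`α`-index. -/
theorem IsPerron.le_degree (hα : α ∈ Set.Ico (0 : ℝ) 1) (h : IsPerron α G lam x) {v : V}
    (hv : ∀ u, G.Adj v u → x u ≤ x v) : lam ≤ G.degree v := by
  have h1 : lam * x v ≤ G.degree v * x v := by
    rw [← h.act_eq, alphaAct, ← Finset.sum_filter, ← G.card_neighborFinset_eq_degree,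
      G.neighborFinset_eq_filter, ← nsmul_eq_mul, ← Finset.sum_const]
    refine Finset.sum_le_sum fun u hu => ?_
    have := hv u (Finset.mem_filter.1 hu).2
    nlinarith [hα.2]
  exact le_of_mul_le_mul_right h1 (h.pos v)

/-- In a connected graph, a clique that misses a vertex has fewer than `lam + 1` vertices. -/
theorem IsPerron.card_clique_lt (hα : α ∈ Set.Ico (0 : ℝ) 1) (hG : G.Connected)
    (h : IsPerron α G lam x) {S : Finset V} (hS : S.Nonempty) (hclique : G.IsClique S) {w : V}
    (hw : w ∉ S) : (S.card : ℝ) - 1 < lam := by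
  classical
  let y : V → ℝ := fun v => if v ∈ S then 1 else 0
  have hyy : ∑ v, y v * y v = S.card := by simp [y]
  have hy0 : ∀ v, 0 ≤ y v := fun v => by simp only [y]; split_ifs <;> norm_num
  have hform : (S.card : ℝ) * (S.card - 1) ≤ alphaForm α G y := by
    have hact : ∀ u ∈ S, (S.card : ℝ) - 1 ≤ alphaAct α G y u := by
      intro u hu
      have hcard : (S.card : ℝ) - 1 = ∑ v ∈ S.erase u, (1 : ℝ) := by
        rw [Finset.sum_const, nsmul_eq_mul, mul_one, Finset.card_erase_of_mem hu,
          Nat.cast_sub (Finset.card_pos.2 hS), Nat.cast_one]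
      rw [hcard, alphaAct]
      refine (Finset.sum_le_sum fun v hv => ?_).trans
        (Finset.sum_le_sum_of_subset_of_nonneg (Finset.subset_univ (S.erase u)) fun v _ _ => ?_)
      · obtain ⟨hvu, hv⟩ := Finset.mem_erase.1 hv
        rw [if_pos (hclique hu hv hvu.symm)]
        simp only [y, if_pos hu, if_pos hv]
        linarith
      · split_ifs
        · exact add_nonneg (mul_nonneg hα.1 (hy0 u)) (mul_nonneg (by linarith [hα.2]) (hy0 v))
        · exact le_rfl
    have hsum : alphaForm α G y = ∑ u ∈ S, alphaAct α G y u := by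
      simp [alphaForm, y]
    rw [hsum, ← nsmul_eq_mul, ← Finset.sum_const]
    exact Finset.sum_le_sum hact
  have hSpos : (0 : ℝ) < S.card := by exact_mod_cast Finset.card_pos.2 hS
  have hmax := h.form_le y
  rw [hyy] at hmax
  refine lt_of_le_of_ne (by nlinarith) fun heq => ?_
  have heig := act_eq_of_form_eq h.form_le
    (le_antisymm (h.form_le y) (by rw [hyy, ← heq]; linarith))
  obtain ⟨s, hs⟩ := hS
  have hpos := pos_of_act_eq hG hα hy0 (fun h0 => by simpa [y, hs] using congrFun h0 s) heig w
  simp [y, hw] at hpos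

end Perron

/-! ### The effect of rewiring edges on the quadratic form -/

section Rewiring

variable {V : Type*} [Fintype V] {α : ℝ}

/-- The contribution of an edge with end values `s` and `t` to the quadratic form of `A_α`. -/
noncomputable def edgeWeight (α s t : ℝ) : ℝ := α * (s ^ 2 + t ^ 2) + 2 * (1 - α) * (s * t)

theorem edgeWeight_nonneg (hα : α ∈ Set.Ico (0 : ℝ) 1) {s t : ℝ} (hs : 0 ≤ s) (ht : 0 ≤ t) :
    0 ≤ edgeWeight α s t := by
  have h1 : 0 ≤ 1 - α := by linarith [hα.2]
  have h2 := hα.1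
  unfold edgeWeight
  positivity

theorem edgeWeight_mono (hα : α ∈ Set.Ico (0 : ℝ) 1) {s t t' : ℝ} (hs : 0 ≤ s) (ht : 0 ≤ t)
    (h : t ≤ t') : edgeWeight α s t ≤ edgeWeight α s t' := by
  have h1 : 0 ≤ 1 - α := by linarith [hα.2]
  have h3 : t ^ 2 ≤ t' ^ 2 := pow_le_pow_left₀ ht h 2
  have h4 : s * t ≤ s * t' := mul_le_mul_of_nonneg_left h hs
  have h5 := mul_le_mul_of_nonneg_left h3 hα.1
  have h6 := mul_le_mul_of_nonneg_left h4 h1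
  unfold edgeWeight
  linarith

open Classical in
/-- If `G` and `H` differ only in edges between `S` and its complement, the difference of their
quadratic forms is a sum over those edges, each counted once. -/
theorem alphaForm_sub_eq (α : ℝ) {G H : SimpleGraph V} (x : V → ℝ) (S : Finset V)
    (hS : ∀ u v, (u ∈ S ↔ v ∈ S) → (H.Adj u v ↔ G.Adj u v)) :
    alphaForm α H x - alphaForm α G x = ∑ u ∈ S, ∑ v,
      ((if H.Adj u v then 1 else 0) - (if G.Adj u v then 1 else 0)) * edgeWeight α (x u) (x v) := by
  let D : V → V → ℝ := fun u v => (if H.Adj u v then 1 else 0) - (if G.Adj u v then 1 else 0)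
  let F : V → V → ℝ := fun u v => α * x u ^ 2 + (1 - α) * (x u * x v)
  have hsymm : ∀ u v, D u v = D v u := fun u v => by
    simp only [D, H.adj_comm u v, G.adj_comm u v]
  have hzero : ∀ u v, (u ∈ S ↔ v ∈ S) → D u v = 0 := fun u v h => by
    simp only [D, hS u v h, sub_self]
  have h1 : alphaForm α H x - alphaForm α G x = ∑ u, ∑ v, D u v * F u v := by
    rw [alphaForm_eq, alphaForm_eq, ← Finset.sum_sub_distrib]
    refine Finset.sum_congr rfl fun u _ => ?_
    rw [← Finset.sum_sub_distrib]
    refine Finset.sum_congr rfl fun v _ => ?_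
    simp only [D, F]
    split_ifs <;> ring
  have h2 : ∑ u ∈ Sᶜ, ∑ v, D u v * F u v = ∑ u ∈ S, ∑ v, D u v * F v u := by
    have hL : ∑ u ∈ Sᶜ, ∑ v, D u v * F u v = ∑ u ∈ Sᶜ, ∑ v ∈ S, D u v * F u v := by
      refine Finset.sum_congr rfl fun u hu => ?_
      refine (Finset.sum_subset (Finset.subset_univ S) fun v _ hv => ?_).symm
      rw [hzero u v (iff_of_false (Finset.mem_compl.1 hu) hv), zero_mul]
    have hR : ∑ u ∈ S, ∑ v, D u v * F v u = ∑ u ∈ S, ∑ v ∈ Sᶜ, D u v * F v u := by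
      refine Finset.sum_congr rfl fun u hu => ?_
      refine (Finset.sum_subset (Finset.subset_univ Sᶜ) fun v _ hv => ?_).symm
      rw [Finset.mem_compl, not_not] at hv
      rw [hzero u v (iff_of_true hu hv), zero_mul]
    rw [hL, hR, Finset.sum_comm]
    exact Finset.sum_congr rfl fun u _ => Finset.sum_congr rfl fun v _ => by rw [hsymm]
  rw [h1, ← Finset.sum_add_sum_compl S, h2, ← Finset.sum_add_distrib]
  refine Finset.sum_congr rfl fun u _ => ?_
  rw [← Finset.sum_add_distrib]
  refine Finset.sum_congr rfl fun v _ => ?_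
  simp only [F, edgeWeight]
  ring

theorem sum_fiber_le {f : V → ℤ} {i : ℤ} (hsub : ∀ v v', f v = i → f v' = i → v = v')
    {F : V → ℝ} {c : ℝ} (hc : 0 ≤ c) (hF : ∀ v, f v = i → F v ≤ c) :
    ∑ v, (if f v = i then F v else 0) ≤ c := by
  by_cases h : ∃ v, f v = i
  · obtain ⟨v, hv⟩ := h
    rw [Finset.sum_eq_single v, if_pos hv]
    · exact hF v hv
    · intro b _ hb
      rw [if_neg fun hb' => hb (hsub b v hb' hv)]
    · exact fun h => absurd (Finset.mem_univ v) h
  · rw [Finset.sum_eq_zero]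
    · exact hc
    · intro v _
      rw [if_neg fun hv => h ⟨v, hv⟩]

end Rewiring

/-! ### Layer graphs -/

section Layers

variable {V : Type*}

/-- The largest graph on `V` in which adjacent vertices lie in equal or consecutive layers of
`f`. -/
def layerGraph (f : V → ℤ) : SimpleGraph V where
  Adj u v := u ≠ v ∧ |f u - f v| ≤ 1
  symm := ⟨fun u v h => ⟨h.1.symm, by rw [abs_sub_comm]; exact h.2⟩⟩
  loopless := ⟨fun _ h => h.1 rfl⟩

theorem layerGraph_adj {f : V → ℤ} {u v : V} :
    (layerGraph f).Adj u v ↔ u ≠ v ∧ |f u - f v| ≤ 1 := Iff.rfl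

theorem layerGraph_mirror (k : ℤ) (f : V → ℤ) :
    layerGraph (fun v => k - f v) = layerGraph f := by
  ext u v
  rw [layerGraph_adj, layerGraph_adj, sub_sub_sub_cancel_left, abs_sub_comm]

/-- The nonempty layers of `f` are exactly those with indices `0, …, k`. -/
structure IsLayering (k : ℤ) (f : V → ℤ) : Prop where
  mem : ∀ v, 0 ≤ f v ∧ f v ≤ k
  surj : ∀ i, 0 ≤ i → i ≤ k → ∃ v, f v = i

variable {k : ℤ} {f : V → ℤ}

theorem IsLayering.mirror (h : IsLayering k f) : IsLayering k (fun v => k - f v) where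
  mem v := by have := h.mem v; omega
  surj i h0 hi := by
    obtain ⟨v, hv⟩ := h.surj (k - i) (by omega) (by omega)
    exact ⟨v, by omega⟩

theorem IsLayering.connected (hk : 0 ≤ k) (h : IsLayering k f) : (layerGraph f).Connected := by
  obtain ⟨o, ho⟩ := h.surj 0 le_rfl hk
  have hreach : ∀ n : ℕ, ∀ v, f v = n → (layerGraph f).Reachable o v := by
    intro n
    induction n with
    | zero =>
      intro v hv
      by_cases hov : o = v
      · rw [hov]
      · exact SimpleGraph.Adj.reachable (layerGraph_adj.2 ⟨hov, by rw [ho, hv]; simp⟩)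
    | succ n ih =>
      intro v hv
      have hvk := (h.mem v).2
      push_cast at hv
      obtain ⟨u, hu⟩ := h.surj n (by omega) (by omega)
      refine (ih u hu).trans (SimpleGraph.Adj.reachable (layerGraph_adj.2 ⟨?_, ?_⟩))
      · rintro rfl
        omega
      · rw [hu, hv]
        simp
  have : Nonempty V := ⟨o⟩
  refine SimpleGraph.Connected.mk fun u v => ?_
  exact (hreach (f u).toNat u (by have := h.mem u; omega)).symm.trans
    (hreach (f v).toNat v (by have := h.mem v; omega))

variable [Fintype V]

open Classical in
theorem degree_layerGraph (f : V → ℤ) (v : V) :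
    (layerGraph f).degree v + (Finset.univ.filter fun u => 1 < |f u - f v|).card + 1
      = Fintype.card V := by
  have h1 : (layerGraph f).neighborFinset v
      = (Finset.univ.filter fun u => |f u - f v| ≤ 1).erase v := by
    ext u
    simp only [SimpleGraph.mem_neighborFinset, layerGraph_adj, Finset.mem_erase,
      Finset.mem_filter, Finset.mem_univ, true_and, abs_sub_comm (f v)]
    tauto
  have h2 := Finset.card_filter_add_card_filter_not (s := Finset.univ)
    (fun u => |f u - f v| ≤ 1)
  have hv : v ∈ Finset.univ.filter fun u => |f u - f v| ≤ 1 := by simp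
  have h3 := Finset.card_erase_add_one hv
  simp only [not_le] at h2
  rw [← SimpleGraph.card_neighborFinset_eq_degree, h1, Finset.card_univ] at *
  omega

open Classical in
/-- The layers far from a vertex number at least `k - 2`. If one of them has two vertices, at least
`k - 1` vertices are not in the closed neighbourhood. -/
theorem IsLayering.degree_le_of_far (h : IsLayering k f) {u w v : V} (huw : u ≠ w)
    (hf : f u = f w) (hfar : 1 < |f u - f v|) :
    ((layerGraph f).degree v : ℤ) ≤ Fintype.card V - k := by
  have h1 := degree_layerGraph f v
  set O := Finset.univ.filter fun u => 1 < |f u - f v| with hO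
  have h2 : (O.image f).card < O.card := by
    refine lt_of_le_of_ne Finset.card_image_le fun heq => huw ?_
    refine Finset.card_image_iff.1 heq ?_ ?_ hf
    · simpa [hO] using hfar
    · simpa [hO, ← hf] using hfar
  have h3 : Finset.Icc 0 k \ Finset.Icc (f v - 1) (f v + 1) ⊆ O.image f := by
    intro i hi
    simp only [Finset.mem_sdiff, Finset.mem_Icc] at hi
    obtain ⟨z, rfl⟩ := h.surj i (by omega) (by omega)
    refine Finset.mem_image_of_mem f ?_
    simp only [hO, Finset.mem_filter, Finset.mem_univ, true_and, lt_abs]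
    omega
  have h4 := Finset.card_le_card h3
  have h5 := Finset.le_card_sdiff (Finset.Icc (f v - 1) (f v + 1)) (Finset.Icc 0 k)
  rw [Int.card_Icc, Int.card_Icc] at h5
  omega

open Classical in
theorem IsLayering.degree_le_of_eq_zero (h : IsLayering k f) {v : V} (hv : f v = 0) :
    ((layerGraph f).degree v : ℤ) ≤ Fintype.card V - k := by
  have h1 := degree_layerGraph f v
  set O := Finset.univ.filter fun u => 1 < |f u - f v| with hO
  have h3 : Finset.Icc 2 k ⊆ O.image f := by
    intro i hi
    simp only [Finset.mem_Icc] at hi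
    obtain ⟨z, rfl⟩ := h.surj i (by omega) (by omega)
    refine Finset.mem_image_of_mem f ?_
    simp only [hO, Finset.mem_filter, Finset.mem_univ, true_and, lt_abs]
    omega
  have h4 := (Finset.card_le_card h3).trans Finset.card_image_le
  rw [Int.card_Icc] at h4
  omega

open Classical in
theorem IsLayering.degree_le_of_eq_top (h : IsLayering k f) {v : V} (hv : f v = k) :
    ((layerGraph f).degree v : ℤ) ≤ Fintype.card V - k := by
  have := h.mirror.degree_le_of_eq_zero (v := v) (by omega)
  rw [SimpleGraph.degree, SimpleGraph.neighborFinset] at this ⊢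
  simp only [layerGraph_mirror] at this
  convert this

end Layers

/-! ### Two moves that increase the `α`-index of a layer graph -/

section Moves

variable {V : Type*} [Fintype V] {α : ℝ} {k : ℤ} {f : V → ℤ} {lam : ℝ} {x : V → ℝ}

open Classical in
/-- Moving part of layer `t` to layer `t + 1` loses the edges to layer `t - 1` and gains edges to
layer `t + 2`. -/
theorem IsPerron.index_lt_shift (hα : α ∈ Set.Ico (0 : ℝ) 1) (h : IsPerron α (layerGraph f) lam x)
    {t : ℤ} {S : Finset V} (hS : ∀ u ∈ S, f u = t) {s w : V} (hs : s ∈ S) (hw : f w = t + 2)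
    (hsub : ∀ v v', f v = t - 1 → f v' = t - 1 → v = v') (hle : ∀ v, f v = t - 1 → x v ≤ x w)
    (hconn : (layerGraph fun v => if v ∈ S then t + 1 else f v).Connected) :
    alphaIndex α (layerGraph f) <
      alphaIndex α (layerGraph fun v => if v ∈ S then t + 1 else f v) := by
  set g : V → ℤ := fun v => if v ∈ S then t + 1 else f v with hg
  have hgS : ∀ v ∈ S, g v = t + 1 := fun v hv => by simp only [hg, if_pos hv]
  have hgN : ∀ v, v ∉ S → g v = f v := fun v hv => by simp only [hg, if_neg hv]
  have hwS : w ∉ S := fun hwS => by have := hS w hwS; omega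
  have hD : ∀ u ∈ S, ∀ v, ((if (layerGraph g).Adj u v then 1 else 0) -
      (if (layerGraph f).Adj u v then 1 else 0) : ℝ) =
      (if f v = t + 2 then 1 else 0) - (if f v = t - 1 then 1 else 0) := by
    intro u hu v
    simp only [layerGraph_adj, abs_le, hgS u hu, hS u hu]
    by_cases hv : v ∈ S
    · simp only [hgS v hv, hS v hv, sub_self]
      split_ifs <;> first | omega | norm_num
    · have huv : u ≠ v := by rintro rfl; exact hv hu
      simp only [hgN v hv, huv, ne_eq, not_false_eq_true, true_and]
      split_ifs <;> first | omega | norm_num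
  refine h.index_lt hα hconn (w := w) ?_ (ne_of_lt ?_)
  · rw [← sub_nonneg, alphaForm_sub_eq α x S]
    · refine Finset.sum_nonneg fun u hu => ?_
      have hsplit : ∑ v, ((if (layerGraph g).Adj u v then 1 else 0) -
          (if (layerGraph f).Adj u v then 1 else 0)) * edgeWeight α (x u) (x v) =
          ∑ v, (if f v = t + 2 then edgeWeight α (x u) (x v) else 0) -
          ∑ v, (if f v = t - 1 then edgeWeight α (x u) (x v) else 0) := by
        rw [← Finset.sum_sub_distrib]
        refine Finset.sum_congr rfl fun v _ => ?_
        rw [hD u hu v, sub_mul, ite_mul, ite_mul, one_mul, zero_mul]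
      have hnn : ∀ v, 0 ≤ edgeWeight α (x u) (x v) := fun v =>
        edgeWeight_nonneg hα (h.pos u).le (h.pos v).le
      have hlost := sum_fiber_le hsub (F := fun v => edgeWeight α (x u) (x v)) (hnn w)
        fun v hv => edgeWeight_mono hα (h.pos u).le (h.pos v).le (hle v hv)
      have hgain := Finset.single_le_sum
        (f := fun v => if f v = t + 2 then edgeWeight α (x u) (x v) else 0)
        (fun v _ => by split_ifs; exacts [hnn v, le_rfl]) (Finset.mem_univ w)
      simp only [if_pos hw] at hgain
      rw [hsplit]
      linarith
    · intro u v huv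
      simp only [layerGraph_adj]
      by_cases hu : u ∈ S
      · have hv := huv.1 hu
        rw [hgS u hu, hgS v hv, hS u hu, hS v hv]
        simp
      · rw [hgN u hu, hgN v fun hv => hu (huv.2 hv)]
  · have hterm : ∀ v, 0 < α * x w + (1 - α) * x v := fun v =>
      add_pos_of_nonneg_of_pos (mul_nonneg hα.1 (h.pos w).le)
        (mul_pos (by linarith [hα.2]) (h.pos v))
    refine Finset.sum_lt_sum (fun v _ => ?_) ⟨s, Finset.mem_univ s, ?_⟩
    · by_cases hv : v ∈ S
      · rw [if_neg]
        · split_ifs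
          exacts [(hterm v).le, le_rfl]
        · rw [layerGraph_adj, abs_le, hS v hv, hw]
          omega
      · simp only [layerGraph_adj, hgN w hwS, hgN v hv, le_refl]
    · rw [if_neg, if_pos]
      · exact hterm s
      · rw [layerGraph_adj, hgS s hs, hgN w hwS, hw]
        refine ⟨?_, by rw [abs_le]; omega⟩
        rintro rfl
        exact hwS hs
      · rw [layerGraph_adj, abs_le, hS s hs, hw]
        omega

open Classical in
/-- Reversing the order of the layers `a, …, b`, when the layers `a - 1, a, b, b + 1` have at most
one vertex each: the two boundary edges are replaced by the two crossing ones. -/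
theorem IsPerron.index_lt_reverse (hα : α ∈ Set.Ico (0 : ℝ) 1)
    (h : IsPerron α (layerGraph f) lam x) {a b : ℤ} (hab : a < b) {A B w : V}
    (hA : ∀ v, f v = a ↔ v = A) (hB : ∀ v, f v = b ↔ v = B) (hw : ∀ v, f v = b + 1 ↔ v = w)
    (hsub : ∀ v v', f v = a - 1 → f v' = a - 1 → v = v') (hle : ∀ v, f v = a - 1 → x v ≤ x w)
    (hlt : x B < x A)
    (hconn : (layerGraph fun v => if a ≤ f v ∧ f v ≤ b then a + b - f v else f v).Connected) :
    alphaIndex α (layerGraph f) <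
      alphaIndex α (layerGraph fun v => if a ≤ f v ∧ f v ≤ b then a + b - f v else f v) := by
  set g : V → ℤ := fun v => if a ≤ f v ∧ f v ≤ b then a + b - f v else f v with hg
  have hgS : ∀ v, (a ≤ f v ∧ f v ≤ b) → g v = a + b - f v := fun v hv => by
    simp only [hg, if_pos hv]
  have hgN : ∀ v, ¬ (a ≤ f v ∧ f v ≤ b) → g v = f v := fun v hv => by simp only [hg, if_neg hv]
  have hfA : f A = a := (hA A).2 rfl
  have hfB : f B = b := (hB B).2 rfl
  have hfw : f w = b + 1 := (hw w).2 rfl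
  have hD : ∀ u v, (a ≤ f u ∧ f u ≤ b) → ¬ (a ≤ f v ∧ f v ≤ b) →
      ((if (layerGraph g).Adj u v then 1 else 0) -
      (if (layerGraph f).Adj u v then 1 else 0) : ℝ) =
      ((if u = A then 1 else 0) - (if u = B then 1 else 0)) *
      ((if v = w then 1 else 0) - (if f v = a - 1 then 1 else 0)) := by
    intro u v hu hv
    have huv : u ≠ v := by rintro rfl; exact hv hu
    simp only [layerGraph_adj, abs_le, hgS u hu, hgN v hv, ← hA, ← hB, ← hw, huv, ne_eq,
      not_false_eq_true, true_and]
    split_ifs <;> first | omega | norm_num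
  have h1α : 0 < 1 - α := by linarith [hα.2]
  refine h.index_lt hα hconn (w := w) ?_ (ne_of_lt ?_)
  · rw [← sub_nonneg, alphaForm_sub_eq α x (Finset.univ.filter fun v => a ≤ f v ∧ f v ≤ b)]
    · have hF : ∀ v, edgeWeight α (x A) (x v) - edgeWeight α (x B) (x v) =
          (x A - x B) * (α * (x A + x B) + 2 * (1 - α) * x v) := fun v => by
        unfold edgeWeight; ring
      have hFnn : ∀ v, 0 ≤ edgeWeight α (x A) (x v) - edgeWeight α (x B) (x v) := fun v => by
        rw [hF]
        refine mul_nonneg (by linarith) (add_nonneg (mul_nonneg hα.1 ?_) (mul_nonneg ?_ ?_))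
        · linarith [h.pos A, h.pos B]
        · linarith
        · exact (h.pos v).le
      have hsum : ∑ u ∈ Finset.univ.filter (fun v => a ≤ f v ∧ f v ≤ b), ∑ v,
          ((if (layerGraph g).Adj u v then 1 else 0) -
          (if (layerGraph f).Adj u v then 1 else 0)) * edgeWeight α (x u) (x v) =
          (edgeWeight α (x A) (x w) - edgeWeight α (x B) (x w)) -
          ∑ v, (if f v = a - 1 then edgeWeight α (x A) (x v) - edgeWeight α (x B) (x v)
            else 0) := by
        have h1 : ∀ u ∈ Finset.univ.filter (fun v => a ≤ f v ∧ f v ≤ b), ∀ v,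
            ((if (layerGraph g).Adj u v then 1 else 0) -
            (if (layerGraph f).Adj u v then 1 else 0)) * edgeWeight α (x u) (x v) =
            ((if u = A then 1 else 0) - (if u = B then 1 else 0)) *
            (((if v = w then 1 else 0) - (if f v = a - 1 then 1 else 0)) *
              edgeWeight α (x u) (x v)) := by
          intro u hu v
          have hu' := (Finset.mem_filter.1 hu).2
          by_cases hv : a ≤ f v ∧ f v ≤ b
          · have hvw : v ≠ w := fun h => by rw [← hw] at h; omega
            have hva : f v ≠ a - 1 := by omega
            have hadj : (layerGraph g).Adj u v ↔ (layerGraph f).Adj u v := by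
              simp only [layerGraph_adj, hgS u hu', hgS v hv, abs_le]
              refine and_congr_right fun _ => ?_
              omega
            simp [hvw, hva, hadj]
          · rw [hD u v hu' hv, mul_assoc]
        rw [Finset.sum_congr rfl fun u hu => (Finset.sum_congr rfl fun v _ => h1 u hu v).trans
          (Finset.mul_sum _ _ _).symm]
        simp only [sub_mul, ite_mul, one_mul, zero_mul]
        rw [Finset.sum_sub_distrib, Finset.sum_ite_eq', Finset.sum_ite_eq', if_pos, if_pos]
        · simp only [Finset.sum_sub_distrib, Finset.sum_ite_eq', Finset.mem_univ, if_true]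
          have h2 : ∀ v, (if f v = a - 1 then edgeWeight α (x A) (x v) - edgeWeight α (x B) (x v)
              else 0) = (if f v = a - 1 then edgeWeight α (x A) (x v) else 0) -
              (if f v = a - 1 then edgeWeight α (x B) (x v) else 0) := fun v => by
            split_ifs <;> ring
          simp only [h2, Finset.sum_sub_distrib]
          ring
        · simp only [Finset.mem_filter, Finset.mem_univ, true_and]; omega
        · simp only [Finset.mem_filter, Finset.mem_univ, true_and]; omega
      rw [hsum, sub_nonneg]
      refine sum_fiber_le hsub (hFnn w) fun v hv => ?_
      rw [hF, hF]
      refine mul_le_mul_of_nonneg_left ?_ (by linarith)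
      have := mul_le_mul_of_nonneg_left (hle v hv) (by linarith : 0 ≤ 2 * (1 - α))
      linarith
    · intro u v huv
      simp only [Finset.mem_filter, Finset.mem_univ, true_and] at huv
      simp only [layerGraph_adj]
      by_cases hu : a ≤ f u ∧ f u ≤ b
      · rw [hgS u hu, hgS v (huv.1 hu), sub_sub_sub_cancel_left, abs_sub_comm]
      · rw [hgN u hu, hgN v fun hv => hu (huv.2 hv)]
  · have hwS : ¬ (a ≤ f w ∧ f w ≤ b) := by omega
    have hdiff : alphaAct α (layerGraph g) x w - alphaAct α (layerGraph f) x w =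
        ∑ v, ((if v = A then α * x w + (1 - α) * x v else 0) -
          (if v = B then α * x w + (1 - α) * x v else 0)) := by
      rw [alphaAct, alphaAct, ← Finset.sum_sub_distrib]
      refine Finset.sum_congr rfl fun v _ => ?_
      by_cases hv : a ≤ f v ∧ f v ≤ b
      · have h1 := hD v w hv hwS
        have hwa : f w ≠ a - 1 := by omega
        simp only [if_true, if_neg hwa, sub_zero, mul_one] at h1
        simp only [SimpleGraph.adj_comm _ w v]
        have h2 := congrArg (· * (α * x w + (1 - α) * x v)) h1
        simpa only [sub_mul, ite_mul, one_mul, zero_mul] using h2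
      · have hvA : v ≠ A := fun h => by rw [← hA] at h; omega
        have hvB : v ≠ B := fun h => by rw [← hB] at h; omega
        simp only [layerGraph_adj, hgN w hwS, hgN v hv, if_neg hvA, if_neg hvB, sub_self]
    rw [← sub_pos, hdiff]
    simp only [Finset.sum_sub_distrib, Finset.sum_ite_eq', Finset.mem_univ, if_true]
    have := mul_lt_mul_of_pos_left hlt h1α
    linarith

end Moves

/-! ### The shape of an optimal layering -/

section Optimal

variable {V : Type*} [Fintype V] {α : ℝ} {k : ℤ} {f : V → ℤ} {lam : ℝ} {x : V → ℝ}

/-- `f` has the largest `α`-index among all layerings of `V` into layers `0, …, k`, and `(lam, x)`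
is a Perron pair of its layer graph. -/
structure IsOptimal (α : ℝ) (k : ℤ) (f : V → ℤ) (lam : ℝ) (x : V → ℝ) : Prop where
  layering : IsLayering k f
  perron : IsPerron α (layerGraph f) lam x
  max : ∀ g : V → ℤ, IsLayering k g → alphaIndex α (layerGraph g) ≤ alphaIndex α (layerGraph f)

theorem IsOptimal.mirror (h : IsOptimal α k f lam x) :
    IsOptimal α k (fun v => k - f v) lam x where
  layering := h.layering.mirror
  perron := by rw [layerGraph_mirror]; exact h.perron
  max g hg := by rw [layerGraph_mirror]; exact h.max g hg

theorem IsLayering.exists_isOptimal (hk : 0 ≤ k) (hα : α ∈ Set.Ico (0 : ℝ) 1) {g : V → ℤ}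
    (hg : IsLayering k g) : ∃ f lam x, IsOptimal α k (V := V) f lam x := by
  have hfin : {f : V → ℤ | IsLayering k f}.Finite := by
    refine (Set.Finite.pi' (t := fun _ : V => Set.Icc 0 k) fun _ => Set.finite_Icc 0 k).subset ?_
    intro f hf v
    exact hf.mem v
  obtain ⟨f, hf, hmax⟩ := Set.exists_max_image _ (fun f => alphaIndex α (layerGraph f)) hfin
    ⟨g, hg⟩
  obtain ⟨lam, x, h⟩ := exists_isPerron (IsLayering.connected hk hf) hα
  exact ⟨f, lam, x, hf, h, hmax⟩

/-- Otherwise moving all vertices of layer `t` but one to layer `t + 1` would increase the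
`α`-index. -/
theorem IsOptimal.exists_lt_below (hα : α ∈ Set.Ico (0 : ℝ) 1) (h : IsOptimal α k f lam x) {t : ℤ}
    {u u' w : V} (hu : f u = t) (hu' : f u' = t) (hne : u ≠ u') (hw : f w = t + 2)
    (hsub : ∀ v v', f v = t - 1 → f v' = t - 1 → v = v') : ∃ v, f v = t - 1 ∧ x w < x v := by
  classical
  by_contra! hcon
  let S : Finset V := (Finset.univ.filter fun v => f v = t).erase u'
  have hS : ∀ v ∈ S, f v = t := fun v hv => (Finset.mem_filter.1 (Finset.mem_of_mem_erase hv)).2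
  have hlay : IsLayering k fun v => if v ∈ S then t + 1 else f v := by
    refine ⟨fun v => ?_, fun i h0 hi => ?_⟩
    · have h1 := h.layering.mem v
      have h2 := h.layering.mem w
      have h3 := h.layering.mem u
      split_ifs <;> omega
    · by_cases hit : i = t
      · exact ⟨u', by simp [S, hu', hit]⟩
      · obtain ⟨v, hv⟩ := h.layering.surj i h0 hi
        refine ⟨v, ?_⟩
        rw [if_neg fun hvS => hit (hv.symm.trans (hS v hvS)), hv]
  have hk : 0 ≤ k := by have := h.layering.mem u; omega
  exact (h.max _ hlay).not_gt (h.perron.index_lt_shift hα hS (s := u) (w := w)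
    (by simp [S, hu, hne]) hw hsub hcon (hlay.connected hk))

theorem IsOptimal.exists_lt_above (hα : α ∈ Set.Ico (0 : ℝ) 1) (h : IsOptimal α k f lam x) {t : ℤ}
    {u u' w : V} (hu : f u = t) (hu' : f u' = t) (hne : u ≠ u') (hw : f w = t - 2)
    (hsub : ∀ v v', f v = t + 1 → f v' = t + 1 → v = v') : ∃ v, f v = t + 1 ∧ x w < x v := by
  obtain ⟨v, hv, hlt⟩ := h.mirror.exists_lt_below hα (t := k - t) (u := u) (u' := u') (w := w)
    (by omega) (by omega) hne (by omega)
    (fun v v' hv hv' => hsub v v' (by omega) (by omega))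
  exact ⟨v, by omega, hlt⟩

/-- Otherwise reversing the layers `a, …, b` would increase the `α`-index. -/
theorem IsOptimal.exists_lt_of_reverse (hα : α ∈ Set.Ico (0 : ℝ) 1) (h : IsOptimal α k f lam x)
    {a b : ℤ} (hab : a < b) {A B w : V} (hA : ∀ v, f v = a ↔ v = A) (hB : ∀ v, f v = b ↔ v = B)
    (hw : ∀ v, f v = b + 1 ↔ v = w) (hsub : ∀ v v', f v = a - 1 → f v' = a - 1 → v = v')
    (hlt : x B < x A) : ∃ v, f v = a - 1 ∧ x w < x v := by
  by_contra! hcon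
  have hmA := h.layering.mem A
  have hmB := h.layering.mem B
  rw [(hA A).2 rfl] at hmA
  rw [(hB B).2 rfl] at hmB
  have hlay : IsLayering k fun v => if a ≤ f v ∧ f v ≤ b then a + b - f v else f v := by
    refine ⟨fun v => ?_, fun i h0 hi => ?_⟩
    · have h1 := h.layering.mem v
      split_ifs <;> omega
    · by_cases hi' : a ≤ i ∧ i ≤ b
      · obtain ⟨v, hv⟩ := h.layering.surj (a + b - i) (by omega) (by omega)
        exact ⟨v, by rw [if_pos (by omega)]; omega⟩
      · obtain ⟨v, hv⟩ := h.layering.surj i h0 hi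
        exact ⟨v, by rw [if_neg (by omega), hv]⟩
  exact (h.max _ hlay).not_gt (h.perron.index_lt_reverse hα hab hA hB hw hsub hcon hlt
    (hlay.connected (by omega)))

/-- The layering with all layers but layer `1` singletons has a clique with `|V| - k + 1`
vertices. -/
theorem IsOptimal.lt_lam (hα : α ∈ Set.Ico (0 : ℝ) 1) (h : IsOptimal α k f lam x) (hk : 2 ≤ k) :
    (Fintype.card V : ℝ) - k < lam := by
  classical
  have : Nonempty V := (h.layering.connected (by omega)).nonempty
  choose! r hr using h.layering.surj
  let g : V → ℤ := fun v => if v = r (f v) then f v else 1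
  have hgr : ∀ i, 0 ≤ i → i ≤ k → g (r i) = i := fun i h0 hi => by simp [g, hr i h0 hi]
  have hglay : IsLayering k g := by
    refine ⟨fun v => ?_, fun i h0 hi => ⟨r i, hgr i h0 hi⟩⟩
    have := h.layering.mem v
    simp only [g]
    split_ifs <;> omega
  have hconn := hglay.connected (by omega)
  obtain ⟨mu, y, hy⟩ := exists_isPerron hconn hα
  let S : Finset V := Finset.univ.filter fun v => g v ≤ 1
  have hclique : (layerGraph g).IsClique S := by
    intro u hu v hv huv
    have h1 := (Finset.mem_filter.1 (Finset.mem_coe.1 hu)).2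
    have h2 := (Finset.mem_filter.1 (Finset.mem_coe.1 hv)).2
    have h3 := hglay.mem u
    have h4 := hglay.mem v
    refine layerGraph_adj.2 ⟨huv, ?_⟩
    rw [abs_le]
    omega
  have hlt := hy.card_clique_lt hα hconn (S := S)
    ⟨r 0, by simp [S, hgr 0 le_rfl (by omega)]⟩ hclique (w := r 2)
    (by simp [S, hgr 2 (by omega) hk])
  have hcompl : Sᶜ.card ≤ (Finset.Icc 2 k).card := by
    refine Finset.card_le_card_of_injOn g (fun v hv => ?_) (fun u hu v hv huv => ?_)
    · have h1 := hglay.mem v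
      simp only [S, Finset.coe_compl, Set.mem_compl_iff, Finset.coe_filter, Finset.mem_univ,
        true_and, Set.mem_ofPred_eq] at hv
      simp only [Finset.coe_Icc, Set.mem_Icc]
      omega
    · simp only [S, Finset.coe_compl, Set.mem_compl_iff, Finset.coe_filter, Finset.mem_univ,
        true_and, Set.mem_ofPred_eq] at hu hv
      have hrep : ∀ z, ¬ g z ≤ 1 → z = r (g z) := by
        intro z hz
        by_cases hzr : z = r (f z)
        · have : g z = f z := if_pos hzr
          rw [this]
          exact hzr
        · exact absurd (if_neg hzr : g z = 1).le hz
      rw [hrep u hu, hrep v hv, huv]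
  rw [Int.card_Icc] at hcompl
  have hcard := Finset.card_add_card_compl S
  have hS : (Fintype.card V : ℤ) - k ≤ (S.card : ℤ) - 1 := by omega
  have hS' : (Fintype.card V : ℝ) - k ≤ (S.card : ℝ) - 1 := by exact_mod_cast hS
  have hmu : mu ≤ lam := by
    have hle := h.max g hglay
    rw [hy.index_eq, h.perron.index_eq] at hle
    exact (ENNReal.ofReal_le_ofReal_iff (h.perron.lam_nonneg hα)).1 hle
  linarith

/-- A vertex `v` far from a large layer has degree at most `|V| - k < lam`, so by the maximum principle
`x` has no local maximum there. -/
theorem IsOptimal.exists_adj_lt (hα : α ∈ Set.Ico (0 : ℝ) 1) (h : IsOptimal α k f lam x)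
    (hk : 2 ≤ k) {u w v : V} (huw : u ≠ w) (hf : f u = f w) (hfar : 1 < |f u - f v|) :
    ∃ z, (layerGraph f).Adj v z ∧ x v < x z := by
  classical
  by_contra! hcon
  have h1 := h.perron.le_degree hα hcon
  have h2 := h.layering.degree_le_of_far huw hf hfar
  have h3 : ((layerGraph f).degree v : ℝ) ≤ Fintype.card V - k := by
    convert (by exact_mod_cast h2 : (((layerGraph f).degree v : ℤ) : ℝ) ≤ Fintype.card V - k)
      using 1
    push_cast
    congr!
  have h4 := h.lt_lam hα hk
  have h5 : lam ≤ (layerGraph f).degree v := by convert h1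
  linarith

/-- All layers with more than one vertex are among three consecutive ones. -/
theorem IsOptimal.exists_three_layers (hα : α ∈ Set.Ico (0 : ℝ) 1) (h : IsOptimal α k f lam x)
    (hk : 2 ≤ k) : ∃ t, 0 < t ∧ t < k ∧
      ∀ u w, f u = f w → 1 < |f u - t| → u = w := by
  classical
  have : Nonempty V := (h.layering.connected (by omega)).nonempty
  obtain ⟨v, -, hv⟩ := Finset.exists_max_image Finset.univ x Finset.univ_nonempty
  have h1 := h.perron.le_degree hα (v := v) fun u _ => hv u (Finset.mem_univ u)
  have h4 := h.lt_lam hα hk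
  have hnot : ¬ (((layerGraph f).degree v : ℤ) ≤ Fintype.card V - k) := by
    intro hle
    have h3 : ((layerGraph f).degree v : ℝ) ≤ Fintype.card V - k := by exact_mod_cast hle
    have h5 : lam ≤ (layerGraph f).degree v := by convert h1
    linarith
  have hm := h.layering.mem v
  refine ⟨f v, lt_of_le_of_ne hm.1 fun h0 => hnot ?_, lt_of_le_of_ne hm.2 fun h0 => hnot ?_,
    fun u w hf hfar => ?_⟩
  · convert h.layering.degree_le_of_eq_zero h0.symm
  · convert h.layering.degree_le_of_eq_top h0
  · by_contra huw
    refine hnot ?_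
    convert h.layering.degree_le_of_far huw hf hfar

/-- Suppose that layers `t - 1` and `t + 1` are both large. By optimality, every vertex `c` of
layer `t + 1` has a smaller entry than the single vertex of layer `t - 2`, and the largest entry on
the layers up to `t - 2` has a still larger neighbour, which must be in layer `t - 1`. -/
theorem IsOptimal.exists_lt_of_two_large (hα : α ∈ Set.Ico (0 : ℝ) 1) (h : IsOptimal α k f lam x)
    (hk : 2 ≤ k) {t : ℤ} (ht : ∀ u w, f u = f w → 1 < |f u - t| → u = w) {a a' b b' : V}
    (ha : f a = t - 1) (ha' : f a' = t - 1) (haa : a ≠ a') (hb : f b = t + 1) (hb' : f b' = t + 1)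
    (hbb : b ≠ b') {c : V} (hc : f c = t + 1) : ∃ z, f z = t - 1 ∧ x c < x z := by
  classical
  obtain ⟨l, hl, hlt⟩ := h.exists_lt_below hα (w := c) ha ha' haa (by omega)
    (fun v v' hv hv' => ht v v' (by omega) (by rw [lt_abs]; omega))
  obtain ⟨s, hs, hmax⟩ := Finset.exists_max_image (Finset.univ.filter fun v => f v ≤ t - 2) x
    ⟨l, by simp only [Finset.mem_filter, Finset.mem_univ, true_and]; omega⟩
  simp only [Finset.mem_filter, Finset.mem_univ, true_and] at hs hmax
  obtain ⟨z, hadj, hz⟩ := h.exists_adj_lt hα hk hbb (v := s) (by omega)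
    (by rw [lt_abs]; omega)
  have h1 := hmax l (by omega)
  have hzt : ¬ f z ≤ t - 2 := fun hzt => (hmax z hzt).not_gt hz
  have h2 := (layerGraph_adj.1 hadj).2
  rw [abs_le] at h2
  exact ⟨z, by omega, by linarith⟩

theorem IsOptimal.not_two_large (hα : α ∈ Set.Ico (0 : ℝ) 1) (h : IsOptimal α k f lam x)
    (hk : 2 ≤ k) {t : ℤ} (ht : ∀ u w, f u = f w → 1 < |f u - t| → u = w) {a a' b b' : V}
    (ha : f a = t - 1) (ha' : f a' = t - 1) (haa : a ≠ a') (hb : f b = t + 1) (hb' : f b' = t + 1)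
    (hbb : b ≠ b') : False := by
  classical
  obtain ⟨c, hc, hmax⟩ := Finset.exists_max_image (Finset.univ.filter fun v => f v = t + 1) x
    ⟨b, by simp [hb]⟩
  simp only [Finset.mem_filter, Finset.mem_univ, true_and] at hc hmax
  obtain ⟨z, hz, hcz⟩ := h.exists_lt_of_two_large hα hk ht ha ha' haa hb hb' hbb hc
  obtain ⟨c', hc', hzc⟩ := h.mirror.exists_lt_of_two_large hα hk (t := k - t) (c := z)
    (fun u w huw hfar => ht u w (by omega) (by rw [lt_abs] at hfar ⊢; omega))
    (a := b) (a' := b') (b := a) (b' := a')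
    (by omega) (by omega) hbb (by omega) (by omega) haa (by omega)
  have := hmax c' (by omega)
  linarith

/-- Two consecutive layers cannot both be large: moving the excess of one to the other gains if the
entry beyond the second layer is at least the entry before the first. -/
theorem IsOptimal.not_consecutive_large (hα : α ∈ Set.Ico (0 : ℝ) 1) (h : IsOptimal α k f lam x)
    (hk : 2 ≤ k) {t : ℤ} (ht : ∀ u w, f u = f w → f u ≠ t → f u ≠ t + 1 → u = w)
    {a a' b b' : V} (ha : f a = t) (ha' : f a' = t) (haa : a ≠ a') (hb : f b = t + 1)
    (hb' : f b' = t + 1) (hbb : b ≠ b') : False := by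
  have hup : ∀ w, f w = t + 2 → ∃ v, f v = t - 1 ∧ x w < x v := fun w hw =>
    h.exists_lt_below hα ha ha' haa hw
      fun v v' hv hv' => ht v v' (by omega) (by omega) (by omega)
  have hdown : ∀ w, f w = t - 1 → ∃ v, f v = t + 2 ∧ x w < x v := fun w hw => by
    obtain ⟨v, hv, hlt⟩ := h.exists_lt_above hα (w := w) hb hb' hbb (by omega)
      fun v v' hv hv' => ht v v' (by omega) (by omega) (by omega)
    exact ⟨v, by omega, hlt⟩
  have hma := h.layering.mem a
  have hmb := h.layering.mem b
  have hex : ∃ w, f w = t + 2 := by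
    by_cases htk : t + 2 ≤ k
    · exact h.layering.surj _ (by omega) htk
    · obtain ⟨w, hw⟩ := h.layering.surj (t - 1) (by omega) (by omega)
      obtain ⟨v, hv, -⟩ := hdown w hw
      exact ⟨v, hv⟩
  obtain ⟨w, hw⟩ := hex
  obtain ⟨v, hv, hlt⟩ := hup w hw
  obtain ⟨w', hw', hlt'⟩ := hdown v hv
  rw [ht w' w (by omega) (by omega) (by omega)] at hlt'
  linarith

theorem IsOptimal.exists_one_layer (hα : α ∈ Set.Ico (0 : ℝ) 1) (h : IsOptimal α k f lam x)
    (hk : 2 ≤ k) : ∃ i, 0 ≤ i ∧ i ≤ k ∧ ∀ u w, f u = f w → f u ≠ i → u = w := by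
  obtain ⟨t, h0, htk, ht⟩ := h.exists_three_layers hα hk
  -- If layer `t - 1` is large, then `t + 1` is not, so the large layers are among `t - 1, t`;
  -- otherwise they are among `t, t + 1`.
  by_cases hA : ∃ a a', f a = t - 1 ∧ f a' = t - 1 ∧ a ≠ a'
  · obtain ⟨a, a', ha, ha', haa⟩ := hA
    have hC : ∀ u w, f u = t + 1 → f w = t + 1 → u = w := fun u w hu hw => by
      by_contra huw
      exact h.not_two_large hα hk ht ha ha' haa hu hw huw
    have hcons : ∀ u w, f u = f w → f u ≠ t - 1 → f u ≠ t - 1 + 1 → u = w := fun u w huw h1 h2 => by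
      by_cases hu : f u = t + 1
      · exact hC u w hu (by omega)
      · exact ht u w huw (by rw [lt_abs]; omega)
    refine ⟨t - 1, by omega, by omega, fun u w huw hu => ?_⟩
    by_cases hut : f u = t
    · by_contra hne
      exact h.not_consecutive_large hα hk hcons ha ha' haa (b := u) (b' := w)
        (by omega) (by omega) hne
    · exact hcons u w huw hu (by omega)
  · have hA' : ∀ u w, f u = t - 1 → f w = t - 1 → u = w := fun u w hu hw => by
      by_contra huw
      exact hA ⟨u, w, hu, hw, huw⟩
    have hcons : ∀ u w, f u = f w → f u ≠ t → f u ≠ t + 1 → u = w := fun u w huw h1 h2 => by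
      by_cases hu : f u = t - 1
      · exact hA' u w hu (by omega)
      · exact ht u w huw (by rw [lt_abs]; omega)
    by_cases hB : ∃ b b', f b = t ∧ f b' = t ∧ b ≠ b'
    · obtain ⟨b, b', hb, hb', hbb⟩ := hB
      refine ⟨t, by omega, by omega, fun u w huw hu => ?_⟩
      by_cases hut : f u = t + 1
      · by_contra hne
        exact h.not_consecutive_large hα hk hcons hb hb' hbb (b := u) (b' := w)
          (by omega) (by omega) hne
      · exact hcons u w huw hu hut
    · refine ⟨t + 1, by omega, by omega, fun u w huw hu => ?_⟩
      by_cases hut : f u = t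
      · by_contra hne
        exact hB ⟨u, w, hut, by omega, hne⟩
      · exact hcons u w huw hut hu

/-- The only large layer `i` is not closer to layer `0` than to layer `k` by two or more. Otherwise the
entries satisfy `x (i + 1 + j) < x (i - j)` for `j = 1` (no shift improves `f`), and inductively for
all larger `j` (no reversal of the layers `i - j, …, i + 1 + j` improves `f`); but layer `i - j` is
empty for `j > i`. -/
theorem IsOptimal.large_layer_central (hα : α ∈ Set.Ico (0 : ℝ) 1) (h : IsOptimal α k f lam x)
    {i : ℤ} (hi : ∀ u w, f u = f w → f u ≠ i → u = w) (hik : 2 * i + 2 ≤ k) {u u' : V}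
    (hu : f u = i) (hu' : f u' = i) : u = u' := by
  by_contra hne
  have hmu := h.layering.mem u
  have hstep : ∀ j : ℕ, ∃ v w, f v = i - 1 - j ∧ f w = i + 2 + j ∧ x w < x v := by
    intro j
    induction j with
    | zero =>
      obtain ⟨w, hw⟩ := h.layering.surj (i + 2) (by omega) (by omega)
      obtain ⟨v, hv, hlt⟩ := h.exists_lt_below hα hu hu' hne hw
        fun v v' hv hv' => hi v v' (by omega) (by omega)
      exact ⟨v, w, by simpa using hv, by simpa using hw, hlt⟩
    | succ j ih =>
      obtain ⟨A, B, hA, hB, hlt⟩ := ih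
      have hmA := h.layering.mem A
      obtain ⟨w, hw⟩ := h.layering.surj (i + 2 + j + 1) (by omega) (by omega)
      obtain ⟨v, hv, hlt'⟩ := h.exists_lt_of_reverse hα (a := i - 1 - j) (b := i + 2 + j)
        (A := A) (B := B) (w := w) (by omega)
        (fun v => ⟨fun hv => hi v A (by omega) (by omega), fun hv => by rw [hv, hA]⟩)
        (fun v => ⟨fun hv => hi v B (by omega) (by omega), fun hv => by rw [hv, hB]⟩)
        (fun v => ⟨fun hv => hi v w (by omega) (by omega), fun hv => by rw [hv, hw]⟩)
        (fun v v' hv hv' => hi v v' (by omega) (by omega)) hlt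
      exact ⟨v, w, by push_cast; omega, by push_cast; omega, hlt'⟩
  obtain ⟨v, w, hv, -, -⟩ := hstep i.toNat
  have := h.layering.mem v
  omega

/-- Up to reflection, the only large layer of an optimal layering is layer `⌊k / 2⌋`. -/
theorem IsOptimal.exists_central (hα : α ∈ Set.Ico (0 : ℝ) 1) (h : IsOptimal α k f lam x)
    (hk : 2 ≤ k) : ∃ g : V → ℤ, IsLayering k g ∧ layerGraph g = layerGraph f ∧
      ∀ u w, g u = g w → g u ≠ k / 2 → u = w := by
  obtain ⟨i, h0, hik, hi⟩ := h.exists_one_layer hα hk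
  by_cases h1 : 2 * i + 2 ≤ k
  · refine ⟨f, h.layering, rfl, fun u w huw _ => ?_⟩
    by_cases hu : f u = i
    · exact h.large_layer_central hα hi h1 hu (by omega)
    · exact hi u w huw hu
  by_cases h2 : 2 * (k - i) + 2 ≤ k
  · refine ⟨f, h.layering, rfl, fun u w huw _ => ?_⟩
    by_cases hu : f u = i
    · exact h.mirror.large_layer_central hα (i := k - i)
        (fun u w huw hu => hi u w (by omega) (by omega)) h2 (by omega) (by omega)
    · exact hi u w huw hu
  by_cases h3 : i = k / 2
  · exact ⟨f, h.layering, rfl, fun u w huw hu => hi u w huw (by omega)⟩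
  · exact ⟨fun v => k - f v, h.layering.mirror, layerGraph_mirror k f,
      fun u w (huw : k - f u = k - f w) (hu : k - f u ≠ k / 2) =>
        hi u w (by omega) (by omega)⟩

end Optimal

/-! ### Identification of the optimal layer graph with `B_{p,q,r}` -/

section Isomorphism

variable {V W : Type*} [Fintype V] [Fintype W] {k c : ℤ}

open Classical in
theorem IsLayering.card_fiber {f : V → ℤ} (h : IsLayering k f)
    (hc : ∀ u w, f u = f w → f u ≠ c → u = w) (hck : 0 ≤ c ∧ c ≤ k) (i : ℤ) :
    ((Finset.univ.filter fun v => f v = i).card : ℤ) =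
      if i = c then Fintype.card V - k else if 0 ≤ i ∧ i ≤ k then 1 else 0 := by
  split_ifs with hic hi
  · subst hic
    have himage : (Finset.univ.filter fun v => ¬ f v = i).image f = (Finset.Icc 0 k).erase i := by
      ext j
      simp only [Finset.mem_image, Finset.mem_filter, Finset.mem_univ, true_and,
        Finset.mem_erase, Finset.mem_Icc]
      constructor
      · rintro ⟨v, hv, rfl⟩
        exact ⟨hv, h.mem v⟩
      · rintro ⟨hj, h0, h1⟩
        obtain ⟨v, rfl⟩ := h.surj j h0 h1
        exact ⟨v, hj, rfl⟩
    have hinj : ((Finset.univ.filter fun v => ¬ f v = i).image f).card =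
        (Finset.univ.filter fun v => ¬ f v = i).card :=
      Finset.card_image_of_injOn fun u hu w _ huw => hc u w huw (by simpa using hu)
    have hsum := Finset.card_filter_add_card_filter_not (s := Finset.univ) (fun v => f v = i)
    rw [himage, Finset.card_erase_of_mem (Finset.mem_Icc.2 hck), Int.card_Icc] at hinj
    rw [Finset.card_univ] at hsum
    omega
  · obtain ⟨v, hv⟩ := h.surj i hi.1 hi.2
    rw [Nat.cast_eq_one, Finset.card_eq_one]
    refine ⟨v, Finset.ext fun u => ?_⟩
    simp only [Finset.mem_filter, Finset.mem_univ, true_and, Finset.mem_singleton]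
    exact ⟨fun hu => hc u v (hu.trans hv.symm) (by rwa [hu]), fun hu => by rw [hu, hv]⟩
  · rw [Nat.cast_eq_zero, Finset.card_eq_zero, Finset.filter_eq_empty_iff]
    rintro v - rfl
    exact hi (h.mem v)

/-- Layer graphs are determined by their layer sizes. -/
theorem IsLayering.nonempty_iso {f : V → ℤ} {g : W → ℤ} (hf : IsLayering k f)
    (hg : IsLayering k g) (hfc : ∀ u w, f u = f w → f u ≠ c → u = w)
    (hgc : ∀ u w, g u = g w → g u ≠ c → u = w) (hck : 0 ≤ c ∧ c ≤ k)
    (hcard : Fintype.card V = Fintype.card W) : Nonempty (layerGraph f ≃g layerGraph g) := by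
  classical
  have hfiber : ∀ i, Nonempty ({v // f v = i} ≃ {w // g w = i}) := by
    intro i
    refine ⟨Fintype.equivOfCardEq ?_⟩
    rw [Fintype.card_subtype, Fintype.card_subtype]
    have h1 := hf.card_fiber hfc hck i
    have h2 := hg.card_fiber hgc hck i
    rw [hcard, ← h2] at h1
    exact_mod_cast h1
  let e : V ≃ W := Equiv.ofFiberEquiv fun i => (hfiber i).some
  have he : ∀ v, g (e v) = f v := fun v => Equiv.ofFiberEquiv_map _ v
  refine ⟨⟨e, ?_⟩⟩
  intro u v
  rw [layerGraph_adj, layerGraph_adj, he, he, e.injective.ne_iff]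

/-- The position of a vertex of `B_{p,q,r}` along the graph: the path `P_q` fills the layers
`0, …, q - 1`, its end `u` last; layer `q` consists of the `p - 2` clique vertices other than `u`
and `v`; the path `P_r` starting at `v` fills the layers `q + 1, …, q + r`. -/
def bugLayer (p q r : ℕ) : (Fin p ⊕ Fin (q - 1)) ⊕ Fin (r - 1) → ℤ
  | .inl (.inl a) => if a.val = 0 then q - 1 else if a.val = 1 then q + 1 else q
  | .inl (.inr j) => q - 2 - j.val
  | .inr j => q + 2 + j.val

theorem bugGraph_eq_layerGraph (p q r : ℕ) (hp : 2 ≤ p) :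
    bugGraph p q r hp = layerGraph (bugLayer p q r) := by
  ext a b
  rcases a with (⟨a, ha⟩ | ⟨a, ha⟩) | ⟨a, ha⟩ <;> rcases b with (⟨b, hb⟩ | ⟨b, hb⟩) | ⟨b, hb⟩ <;>
    simp only [bugGraph, attachPath, bugLayer, layerGraph_adj, abs_le, SimpleGraph.deleteEdges_adj,
      SimpleGraph.top_adj, Set.mem_singleton_iff, Sym2.eq_iff, ne_eq, Sum.inl.injEq, Sum.inr.injEq,
      Fin.mk.injEq, reduceCtorEq, not_false_eq_true, true_and, false_and, false_iff] <;>
    (try split_ifs) <;> omega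

theorem isLayering_bugLayer {p q r : ℕ} (hp : 3 ≤ p) (hq : 1 ≤ q) (hr : 1 ≤ r) :
    IsLayering ((q + r : ℕ) : ℤ) (bugLayer p q r) := by
  refine ⟨?_, fun i h0 hi => ?_⟩
  · rintro ((⟨a, ha⟩ | ⟨a, ha⟩) | ⟨a, ha⟩) <;> simp only [bugLayer] <;> push_cast
    · split_ifs <;> omega
    · omega
    · omega
  · rcases lt_trichotomy i q with hlt | rfl | hgt
    · by_cases hi1 : i = q - 1
      · exact ⟨.inl (.inl ⟨0, by omega⟩), by simp [bugLayer, hi1]⟩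
      · exact ⟨.inl (.inr ⟨(q - 2 - i).toNat, by omega⟩), by simp only [bugLayer]; omega⟩
    · exact ⟨.inl (.inl ⟨2, by omega⟩), by simp [bugLayer]⟩
    · by_cases hi1 : i = q + 1
      · exact ⟨.inl (.inl ⟨1, by omega⟩), by simp [bugLayer, hi1]⟩
      · exact ⟨.inr ⟨(i - q - 2).toNat, by omega⟩, by simp only [bugLayer]; omega⟩

theorem bugLayer_injective_off (p q r : ℕ) (a b : (Fin p ⊕ Fin (q - 1)) ⊕ Fin (r - 1))
    (hab : bugLayer p q r a = bugLayer p q r b) (ha : bugLayer p q r a ≠ q) : a = b := by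
  revert hab ha
  rcases a with (⟨a, ha⟩ | ⟨a, ha⟩) | ⟨a, ha⟩ <;> rcases b with (⟨b, hb⟩ | ⟨b, hb⟩) | ⟨b, hb⟩ <;>
    simp only [bugLayer, Sum.inl.injEq, Sum.inr.injEq, Fin.mk.injEq, reduceCtorEq] <;>
    (try split_ifs) <;> omega

theorem IsLayering.lt_card {f : V → ℤ} (h : IsLayering k f) : k < Fintype.card V := by
  classical
  have h1 : Finset.Icc 0 k ⊆ Finset.univ.image f := by
    intro i hi
    rw [Finset.mem_Icc] at hi
    obtain ⟨v, rfl⟩ := h.surj i hi.1 hi.2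
    exact Finset.mem_image_of_mem f (Finset.mem_univ v)
  have h2 := (Finset.card_le_card h1).trans Finset.card_image_le
  rw [Int.card_Icc, Finset.card_univ] at h2
  omega

theorem IsOptimal.nonempty_iso_bugGraph {α : ℝ} (hα : α ∈ Set.Ico (0 : ℝ) 1) {k : ℕ} (hk : 2 ≤ k)
    {f : V → ℤ} {lam : ℝ} {x : V → ℝ} (h : IsOptimal α k f lam x) :
    Nonempty (layerGraph f ≃g bugGraph (Fintype.card V - k + 2) (k / 2) ((k + 1) / 2)
      (Nat.le_add_left 2 (Fintype.card V - k))) := by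
  obtain ⟨g, hg, hgf, hgc⟩ := h.exists_central hα (by exact_mod_cast hk)
  have hlt := hg.lt_card
  have hbug := isLayering_bugLayer (p := Fintype.card V - k + 2) (q := k / 2) (r := (k + 1) / 2)
    (by omega) (by omega) (by omega)
  rw [show k / 2 + (k + 1) / 2 = k by omega] at hbug
  rw [← hgf, bugGraph_eq_layerGraph]
  refine hg.nonempty_iso hbug (c := ((k / 2 : ℕ) : ℤ)) (fun u w huw hu => hgc u w huw ?_)
    (bugLayer_injective_off _ _ _) (by omega) ?_
  · exact_mod_cast hu
  · simp only [Fintype.card_sum, Fintype.card_fin]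
    omega

end Isomorphism

/-! ### Comparison with the extremal graphs -/

/-- The distance to an end of a diametral path, cut off at `k`, is a layering. -/
theorem exists_isLayering_of_le_diam {V : Type*} {G : SimpleGraph V} (hG : G.Connected) {k : ℕ}
    (hk : k ≤ G.diam) : ∃ f : V → ℤ, IsLayering k f ∧ G ≤ layerGraph f := by
  have := hG.nonempty
  obtain ⟨o, z, hoz⟩ := G.exists_dist_eq_diam
  have hadj : ∀ u v, G.Adj u v → G.dist o v ≤ G.dist o u + 1 := fun u v huv => by
    rw [← SimpleGraph.dist_eq_one_iff_adj.2 huv]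
    exact hG.dist_triangle
  have hivt : ∀ (a b : V) (_ : G.Walk a b) (i : ℕ), G.dist o a ≤ i → i ≤ G.dist o b →
      ∃ v, G.dist o v = i := by
    intro a b p
    induction p with
    | nil => exact fun i h1 h2 => ⟨_, le_antisymm h1 h2⟩
    | cons h _ ih =>
      intro i h1 h2
      rcases h1.eq_or_lt with heq | hlt
      · exact ⟨_, heq⟩
      · exact ih i ((hadj _ _ h).trans hlt) h2
  refine ⟨fun v => ((min (G.dist o v) k : ℕ) : ℤ), ⟨fun v => ?_, fun i h0 hi => ?_⟩, ?_⟩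
  · omega
  · obtain ⟨p⟩ := hG.preconnected o z
    obtain ⟨v, hv⟩ := hivt o z p i.toNat (by simp) (by omega)
    exact ⟨v, by omega⟩
  · intro u v huv
    have h1 := hadj u v huv
    have h2 := hadj v u huv.symm
    refine layerGraph_adj.2 ⟨huv.ne, ?_⟩
    rw [abs_le]
    omega

theorem alphaIndex_le_top {V : Type*} [Fintype V] {n : ℕ} (hn : Fintype.card V = n)
    {G : SimpleGraph V} (hG : G.Connected) {α : ℝ} (hα : α ∈ Set.Ico (0 : ℝ) 1) :
    alphaIndex α G ≤ alphaIndex α (⊤ : SimpleGraph (Fin n)) ∧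
      (alphaIndex α G = alphaIndex α (⊤ : SimpleGraph (Fin n)) ↔
        Nonempty (G ≃g (⊤ : SimpleGraph (Fin n)))) := by
  have e : (⊤ : SimpleGraph V) ≃g (⊤ : SimpleGraph (Fin n)) :=
    SimpleGraph.Iso.completeGraph (Fintype.equivFinOfCardEq hn)
  rw [← alphaIndex_congr α e]
  refine ⟨alphaIndex_le_of_le hα hG le_top, fun heq => ?_, fun ⟨e'⟩ => ?_⟩
  · rcases (le_top : G ≤ ⊤).eq_or_lt with rfl | hlt
    · exact ⟨e⟩
    · exact absurd heq (alphaIndex_lt_of_lt hα hG hlt).ne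
  · exact alphaIndex_congr α (e'.trans e.symm)

theorem alphaIndex_le_bugGraph {V : Type*} [Fintype V] {G : SimpleGraph V} (hG : G.Connected)
    {α : ℝ} (hα : α ∈ Set.Ico (0 : ℝ) 1) {k : ℕ} (hk : k ≤ G.diam) (hk2 : 2 ≤ k)
    {B : SimpleGraph ((Fin (Fintype.card V - k + 2) ⊕ Fin (k / 2 - 1)) ⊕ Fin ((k + 1) / 2 - 1))}
    (hB : B = bugGraph (Fintype.card V - k + 2) (k / 2) ((k + 1) / 2)
      (Nat.le_add_left 2 (Fintype.card V - k))) :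
    alphaIndex α G ≤ alphaIndex α B ∧
      (alphaIndex α G = alphaIndex α B ↔ Nonempty (G ≃g B)) := by
  subst hB
  obtain ⟨g, hg, hGg⟩ := exists_isLayering_of_le_diam hG hk
  obtain ⟨f, lam, x, hf⟩ := hg.exists_isOptimal (by omega) hα
  obtain ⟨e⟩ := hf.nonempty_iso_bugGraph hα hk2
  have hle := alphaIndex_le_of_le hα hG hGg
  rw [← alphaIndex_congr α e]
  refine ⟨hle.trans (hf.max g hg), fun heq => ?_, fun ⟨e'⟩ => ?_⟩
  · obtain ⟨mu, y, hy⟩ := exists_isPerron (hg.connected (by omega)) hα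
    have hgopt : IsOptimal α k g mu y :=
      ⟨hg, hy, fun g' hg' => (hf.max g' hg').trans (heq ▸ hle)⟩
    rcases hGg.eq_or_lt with rfl | hlt
    · exact hgopt.nonempty_iso_bugGraph hα hk2
    · exact absurd heq ((alphaIndex_lt_of_lt hα hG hlt).trans_le (hf.max g hg)).ne
  · exact alphaIndex_congr α (e'.trans e.symm)

theorem theorem3 {V : Type*} [Fintype V] (n : ℕ) (hn : Fintype.card V = n)
    (G : SimpleGraph V) (hG : G.Connected) (α : ℝ) (hα : α ∈ Set.Ico (0 : ℝ) 1)
    (k : ℕ) (hk : k ≤ G.diam) :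
    (k = 1 →
      alphaIndex α G ≤ alphaIndex α (⊤ : SimpleGraph (Fin n)) ∧
      (alphaIndex α G = alphaIndex α (⊤ : SimpleGraph (Fin n)) ↔
        Nonempty (G ≃g (⊤ : SimpleGraph (Fin n)))) ∧
      (G.diam = 1 → alphaIndex α G = alphaIndex α (⊤ : SimpleGraph (Fin n)))) ∧
    (2 ≤ k →
      alphaIndex α G ≤
        alphaIndex α (bugGraph (n - k + 2) (k / 2) ((k + 1) / 2) (Nat.le_add_left 2 (n - k))) ∧
      (alphaIndex α G =
          alphaIndex α (bugGraph (n - k + 2) (k / 2) ((k + 1) / 2) (Nat.le_add_left 2 (n - k))) ↔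
        Nonempty (G ≃g
          bugGraph (n - k + 2) (k / 2) ((k + 1) / 2) (Nat.le_add_left 2 (n - k))))) := by
  refine ⟨fun _ => ?_, fun hk2 => ?_⟩
  · obtain ⟨hle, hiff⟩ := alphaIndex_le_top hn hG hα
    refine ⟨hle, hiff, fun hdiam => hiff.2 ?_⟩
    have : Nontrivial V := G.nontrivial_of_diam_ne_zero (by omega)
    rw [SimpleGraph.diam_eq_one.1 hdiam]
    exact ⟨SimpleGraph.Iso.completeGraph (Fintype.equivFinOfCardEq hn)⟩
  · subst hn
    exact alphaIndex_le_bugGraph hG hα hk hk2 rfl
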